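/- All graphs are finite and simple. For a graph $G$, let $\rho(G)$ denote its spectral radius, i.e. the largest eigenvalue of its adjacency matrix. A $k$-factor of $G$ is a $k$-regular spanning subgraph of $G$. For an integer $l$, the $l$-closure $C_l(G)$ is the graph obtained from $G$ by successively joining pairs of nonadjacent vertices whose degree sum is at least $l$ until no such pair exists (the result does not depend on the order). $K_m$ is the complete graph on $m$ vertices, $I_m$ is the graph with $m$ vertices and no edges, $G_1+G_2$ is the disjoint union, and $G_1\vee G_2$ is the join, i.e. $G_1+G_2$ together with all edges between $V(G_1)$ and $V(G_2)$. Let $\delta$ be a nonnegative integer and let $G$ be a graph of order $n$ with minimum degree at least $\delta$. (i) Suppose that $n$ is even, $1\le\delta\le\frac n2-1$, $n\ge 6\delta+10$ and $$\rho(G)>\frac{\delta-1}{2}+\sqrt{n^{2}-(3\delta+5)n+\frac{13\delta^{2}+23\delta+41}{4}}.$$ Then $G$ has a $1$-factor, unless either $\delta$ is even and $C_{n-1}(G)\cong K_{n-\delta-1}+K_{\delta+1}$, or $C_{n-1}(G)\cong K_{\delta}\vee(K_{n-2\delta-1}+I_{\delta+1})$. (ii) Let $k\ge 2$ be an integer with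 $nk$ even, and suppose that $2k-2\le\delta\le\left\lfloor\frac{n+2k-5}{2}\right\rfloor$, $n\ge 6\delta+4k-3$ and $$\rho(G)>\frac{\delta-1}{2}+\sqrt{n^{2}-(3\delta-4k+11)n+\frac{13\delta^{2}-(32k-94)\delta+16k^{2}-104k+161}{4}}.$$ Then $G$ has a $k$-factor. -/

import Mathlib

namespace FactorSpectral

/-- The largest eigenvalue of the adjacency matrix of a finite graph
(junk value `0` only for the graph without vertices). -/
noncomputable def spectralRadius {V : Type*} [Fintype V] [DecidableEq V] (G : SimpleGraph V)
    [DecidableRel G.Adj] : ℝ :=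
  sSup {μ : ℝ | Module.End.HasEigenvalue (Matrix.toLin' (G.adjMatrix ℝ)) μ}

open Classical in
/-- `G` has a `k`-factor: a `k`-regular spanning subgraph. -/
def HasFactor {V : Type*} [Fintype V] (G : SimpleGraph V) (k : ℕ) : Prop :=
  ∃ F : SimpleGraph V, F ≤ G ∧ F.IsRegularOfDegree k

/-- The join of two vertex-disjoint graphs: the disjoint union together with all edges between
the two parts. -/
def join {V W : Type*} (G : SimpleGraph V) (H : SimpleGraph W) : SimpleGraph (V ⊕ W) :=
  (G ⊕g H) ⊔ completeBipartiteGraph V W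

open Classical in
/-- One step of the `l`-closure process: `H` arises from `G` by joining two distinct nonadjacent
vertices whose degree sum in `G` is at least `l`. -/
def ClosureStep {V : Type*} [Fintype V] (l : ℕ) (G H : SimpleGraph V) : Prop :=
  ∃ u v : V, u ≠ v ∧ ¬ G.Adj u v ∧ l ≤ G.degree u + G.degree v ∧ H = G ⊔ SimpleGraph.edge u v

/-- `H` is the end result of a run of the `l`-closure process started at `G`: it is reached by
finitely many steps, and no further step is possible. -/
def IsClosure {V : Type*} [Fintype V] (l : ℕ) (G H : SimpleGraph V) : Prop :=
  Relation.ReflTransGen (ClosureStep l) G H ∧ ∀ K, ¬ ClosureStep l H K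

theorem ClosureStep.lt {V : Type*} [Fintype V] {l : ℕ} {G H : SimpleGraph V}
    (h : ClosureStep l G H) : G < H := by
  obtain ⟨u, v, huv, hn, -, rfl⟩ := h
  refine lt_of_le_of_ne le_sup_left fun he => hn ?_
  rw [he]
  exact Or.inr (by simp [SimpleGraph.edge_adj, huv])

theorem exists_isClosure {V : Type*} [Fintype V] (l : ℕ) (G : SimpleGraph V) :
    ∃ H, IsClosure l G H := by
  induction G using (wellFounded_gt (α := SimpleGraph V)).induction with
  | _ G ih =>
    by_cases h : ∃ K, ClosureStep l G K
    · obtain ⟨K, hK⟩ := h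
      obtain ⟨H, hH, hc⟩ := ih K hK.lt
      exact ⟨H, Relation.ReflTransGen.head hK hH, hc⟩
    · exact ⟨G, Relation.ReflTransGen.refl, fun K hK => h ⟨K, hK⟩⟩

/-- Every graph reached from `G` lies below every graph above `G` that admits no further step. -/
theorem le_of_reflTransGen {V : Type*} [Fintype V] {l : ℕ} {G H K : SimpleGraph V}
    (h : Relation.ReflTransGen (ClosureStep l) G H) (hGK : G ≤ K)
    (hK : ∀ K', ¬ ClosureStep l K K') : H ≤ K := by
  classical
  induction h with
  | refl => exact hGK
  | tail _ hs ih =>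
    obtain ⟨u, v, huv, -, hd, rfl⟩ := hs
    refine sup_le ih ?_
    have hadj : K.Adj u v := by
      by_contra hn
      refine hK _ ⟨u, v, huv, hn, hd.trans (add_le_add ?_ ?_), rfl⟩ <;>
        exact SimpleGraph.degree_le_of_le ih
    exact (SimpleGraph.edge_le_iff (G := K)).2 (Or.inr hadj)

/-- The outcome of the closure process does not depend on the order of the steps. -/
theorem IsClosure.unique {V : Type*} [Fintype V] {l : ℕ} {G H K : SimpleGraph V}
    (hH : IsClosure l G H) (hK : IsClosure l G K) : H = K := by
  have le : ∀ {A : SimpleGraph V}, Relation.ReflTransGen (ClosureStep l) G A → G ≤ A := by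
    intro A hA
    induction hA with
    | refl => exact le_rfl
    | tail _ hs ih => exact ih.trans hs.lt.le
  exact le_antisymm (le_of_reflTransGen hH.1 (le hK.1) hK.2)
    (le_of_reflTransGen hK.1 (le hH.1) hH.2)

/-- The `l`-closure `C_l(G)`: the graph obtained from `G` by successively joining pairs of
nonadjacent vertices whose degree sum is at least `l` until no such pair exists. -/
noncomputable def closure {V : Type*} [Fintype V] (l : ℕ) (G : SimpleGraph V) : SimpleGraph V :=
  (exists_isClosure l G).choose

theorem closure_spec {V : Type*} [Fintype V] (l : ℕ) (G : SimpleGraph V) :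
    IsClosure l G (closure l G) :=
  (exists_isClosure l G).choose_spec

end FactorSpectral

/-! Put `l = n - 1` for `k = 1` and `l = n + 2k - 4` for `k ≥ 2`. A closure step does not create
a `k`-factor: deleting the new edge `uv` from a `k`-factor leaves a subgraph `F` that lacks one
edge at `u` and one at `v`, and counting the edges of `F` at common neighbours of `u` and `v`
yields a trail from `u` to `v`, alternating between spare edges and edges of `F`, along which `F`
can be switched to a `k`-factor. So `G` may be replaced by its closure `H`.

The absolute values `x` of an eigenvector of `G` for `ρ` satisfy `ρ x ≤ A x` for the adjacency
matrix `A` of `H`. Comparing the maximum of `x` with its values on a set of vertices of low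
degree shows that, for large `ρ`, at most `n + δ - l` vertices of `H` have degree less than
`l / 2`. The others form a clique.

If the set `B` of exceptional vertices is completely joined to this clique, then `H` is complete.
Otherwise `#B = n + δ - l`, all of `B` has degree `δ` and the same neighbours in the clique, and
adding a missing edge `bw` makes the closure complete. This gives a subgraph `F` that lacks one
edge at `b ∈ B` and one at `w ∉ B`. An alternating trail from `b` into the clique moves the first
defect there, where it is easily repaired. Such a trail can fail to exist only for `k = 1`, when
`B` is a clique of odd size without neighbours outside `B`, or an independent set. -/

namespace FactorSpectral

open Finset

section Spectral

variable {V : Type*} [Fintype V] {G H : SimpleGraph V} [DecidableRel G.Adj] [DecidableRel H.Adj]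
  {ρ : ℝ} {x : V → ℝ}

/-- A nonzero nonnegative vector `x` with `ρ x ≤ A x` entrywise, `A` the adjacency matrix of `G`.
Unlike eigenvectors, such vectors survive the insertion of edges into `G`. -/
structure IsSubeigenvector (G : SimpleGraph V) [DecidableRel G.Adj] (ρ : ℝ) (x : V → ℝ) :
    Prop where
  nonneg : ∀ v, 0 ≤ x v
  ne_zero : x ≠ 0
  mul_le : ∀ v, ρ * x v ≤ ∑ u ∈ G.neighborFinset v, x u

theorem exists_isSubeigenvector_spectralRadius [DecidableEq V] [Nonempty V] (G : SimpleGraph V)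
    [DecidableRel G.Adj] : ∃ x, IsSubeigenvector G (spectralRadius G) x := by
  set s := {μ : ℝ | Module.End.HasEigenvalue (Matrix.toLin' (G.adjMatrix ℝ)) μ}
  have hρ : spectralRadius G = sSup s := rfl
  rcases s.eq_empty_or_nonempty with hempty | hne
  · exact ⟨1, fun _ => zero_le_one, one_ne_zero, fun v => by simp [hρ, hempty]⟩
  · obtain ⟨z, hz⟩ : ∃ z, Module.End.HasEigenvector (Matrix.toLin' (G.adjMatrix ℝ)) (sSup s) z :=
      (hne.csSup_mem (Module.End.finite_hasEigenvalue _)).exists_hasEigenvector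
    refine ⟨fun v => |z v|, fun v => abs_nonneg _, fun h => hz.2 ?_, fun v => ?_⟩
    · exact funext fun v => abs_eq_zero.1 (congrFun h v)
    · have heigen : ∑ u ∈ G.neighborFinset v, z u = sSup s * z v := by
        simpa [SimpleGraph.adjMatrix_mulVec_apply] using congrFun hz.apply_eq_smul v
      calc sSup s * |z v| ≤ |sSup s| * |z v| := by gcongr; exact le_abs_self _
        _ = |∑ u ∈ G.neighborFinset v, z u| := by rw [heigen, abs_mul]
        _ ≤ ∑ u ∈ G.neighborFinset v, |z u| := abs_sum_le_sum_abs _ _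

namespace IsSubeigenvector

theorem mono (hx : IsSubeigenvector G ρ x) (hGH : G ≤ H) : IsSubeigenvector H ρ x where
  nonneg := hx.nonneg
  ne_zero := hx.ne_zero
  mul_le v := (hx.mul_le v).trans <| sum_le_sum_of_subset_of_nonneg
    (fun u hu => by simpa using hGH (by simpa using hu)) fun u _ _ => hx.nonneg u

theorem exists_pos_max (hx : IsSubeigenvector G ρ x) : ∃ w, 0 < x w ∧ ∀ v, x v ≤ x w := by
  obtain ⟨v, hv⟩ := Function.ne_iff.1 hx.ne_zero
  have : Nonempty V := ⟨v⟩
  obtain ⟨w, hw⟩ := Finite.exists_max x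
  exact ⟨w, ((hx.nonneg v).lt_of_ne' hv).trans_le (hw v), hw⟩

theorem mul_le_mul_of_degree_le (hx : IsSubeigenvector G ρ x) {v : V} {e : ℕ} {T : ℝ}
    (hv : G.degree v ≤ e) (hT : ∀ u, x u ≤ T) : ρ * x v ≤ e * T := by
  have hT₀ : 0 ≤ T := (hx.nonneg v).trans (hT v)
  calc ρ * x v ≤ ∑ u ∈ G.neighborFinset v, x u := hx.mul_le v
    _ ≤ #(G.neighborFinset v) • T := sum_le_card_nsmul _ _ _ fun u _ => hT u
    _ = G.degree v * T := by rw [nsmul_eq_mul, G.card_neighborFinset_eq_degree]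
    _ ≤ e * T := by gcongr

variable {B : Finset V}

theorem add_one_mul_le [DecidableEq V] (hx : IsSubeigenvector G ρ x) {w : V} (hw : w ∉ B) :
    (ρ + 1) * x w ≤ ∑ u ∈ Bᶜ, x u + ∑ v ∈ B with G.Adj w v, x v := by
  have hsplit : ∑ u ∈ G.neighborFinset w, x u =
      ∑ u ∈ Bᶜ with G.Adj w u, x u + ∑ v ∈ B with G.Adj w v, x v := by
    rw [add_comm, G.neighborFinset_eq_filter, sum_filter, sum_filter, sum_filter, sum_add_sum_compl]
  have houter : ∑ u ∈ Bᶜ with G.Adj w u, x u ≤ ∑ u ∈ Bᶜ, x u - x w := by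
    rw [← sum_erase_eq_sub (mem_compl.2 hw)]
    refine sum_le_sum_of_subset_of_nonneg (fun u hu => ?_) fun u _ _ => hx.nonneg u
    obtain ⟨hu, hwu⟩ := mem_filter.1 hu
    exact mem_erase.2 ⟨hwu.ne', hu⟩
  linarith [hx.mul_le w]

theorem sum_compl_sum_adj_le [DecidableEq V] (hx : IsSubeigenvector G ρ x) {e : ℕ} {M : ℝ}
    (hdeg : ∀ v ∈ B, G.degree v ≤ e) (hM : ∀ v ∈ B, x v ≤ M) :
    ∑ w ∈ Bᶜ, ∑ v ∈ B with G.Adj w v, x v ≤ #B * (e * M) := by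
  simp_rw [sum_filter]
  rw [sum_comm, ← nsmul_eq_mul]
  refine sum_le_card_nsmul _ _ _ fun v hv => ?_
  have hcard : #{w ∈ Bᶜ | G.Adj w v} ≤ e := by
    refine le_trans (card_le_card fun w hw => ?_) (hdeg v hv)
    exact (G.mem_neighborFinset v w).2 (mem_filter.1 hw).2.symm
  rw [← sum_filter, sum_const, nsmul_eq_mul]
  have := hx.nonneg v
  have := hM v hv
  gcongr

theorem add_one_mul_le_of_forall_le [DecidableEq V] (hx : IsSubeigenvector G ρ x) {M : ℝ}
    (hM₀ : 0 ≤ M) (hM : ∀ v ∈ B, x v ≤ M) {w : V} (hw : w ∉ B) :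
    (ρ + 1) * x w ≤ ∑ u ∈ Bᶜ, x u + #B * M := by
  refine (hx.add_one_mul_le hw).trans (add_le_add_right ?_ _)
  calc ∑ v ∈ B with G.Adj w v, x v ≤ #{v ∈ B | G.Adj w v} • M :=
        sum_le_card_nsmul _ _ _ fun v hv => hM v (mem_of_mem_filter v hv)
    _ = #{v ∈ B | G.Adj w v} * M := nsmul_eq_mul _ _
    _ ≤ #B * M := by gcongr; exact filter_subset _ _

theorem card_bound (hx : IsSubeigenvector G ρ x) {e : ℕ} (hB : B.Nonempty)
    (hdeg : ∀ v ∈ B, G.degree v ≤ e) (he : e < ρ) (hBρ : #B ≤ ρ + 1) :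
    (ρ + 1 - Fintype.card V + #B) * (ρ * (ρ + 1) - e * #B) ≤ #B * (e : ℝ) ^ 2 := by
  classical
  have hρ : 0 < ρ := (Nat.cast_nonneg e).trans_lt he
  obtain ⟨m, hmB, hm⟩ := B.exists_max_image x hB
  obtain ⟨w, hw₀, hw⟩ := hx.exists_pos_max
  have hwB : w ∉ B := fun h => by
    have := hx.mul_le_mul_of_degree_le (hdeg w h) hw
    exact absurd he (le_of_mul_le_mul_right this hw₀).not_gt
  set p := ∑ u ∈ Bᶜ, x u with hp
  have hwp : x w ≤ p := single_le_sum (fun u _ => hx.nonneg u) (mem_compl.2 hwB)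
  have hinner : x m * (ρ * (ρ + 1) - e * #B) ≤ e * p := by
    have h₁ : ρ * x m ≤ e * x w := hx.mul_le_mul_of_degree_le (hdeg m hmB) hw
    have h₂ : (ρ + 1) * x w ≤ p + #B * x m := hx.add_one_mul_le_of_forall_le (hx.nonneg m) hm hwB
    have h₃ : (ρ + 1) * (ρ * x m) ≤ (ρ + 1) * (e * x w) := by gcongr
    have h₄ : e * ((ρ + 1) * x w) ≤ e * (p + #B * x m) := by gcongr
    linarith
  have houter : (ρ + 1 - Fintype.card V + #B) * p ≤ #B * (e * x m) := by
    have h₁ := sum_le_sum fun w hw => hx.add_one_mul_le (w := w) (mem_compl.1 hw : w ∉ B)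
    have h₂ := hx.sum_compl_sum_adj_le hdeg hm
    rw [← mul_sum, sum_add_distrib, sum_const, nsmul_eq_mul, card_compl,
      Nat.cast_sub (card_le_univ B), ← hp] at h₁
    linarith
  have hD : 0 ≤ ρ * (ρ + 1) - e * #B := sub_nonneg.2 (by gcongr)
  refine le_of_mul_le_mul_right ?_ (hw₀.trans_le hwp)
  calc (ρ + 1 - Fintype.card V + #B) * (ρ * (ρ + 1) - e * #B) * p
      = (ρ + 1 - Fintype.card V + #B) * p * (ρ * (ρ + 1) - e * #B) := by ring
    _ ≤ #B * (e * x m) * (ρ * (ρ + 1) - e * #B) := by gcongr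
    _ = #B * e * (x m * (ρ * (ρ + 1) - e * #B)) := by ring
    _ ≤ #B * e * (e * p) := by gcongr
    _ = #B * (e : ℝ) ^ 2 * p := by ring

end IsSubeigenvector

end Spectral

section Estimates

/-- The cubic in `b` whose positivity contradicts `IsSubeigenvector.card_bound` for a set of `b`
vertices of degree at most `b + l - n` in a graph on `n` vertices. -/
def gap (n l ρ b : ℝ) : ℝ :=
  (ρ + 1 - n + b) * (ρ * (ρ + 1) - (b + l - n) * b) - b * (b + l - n) ^ 2

theorem gap_pos_of_endpoints {n l ρ b b₁ b₂ : ℝ} (h₁ : b₁ ≤ b) (h₂ : b ≤ b₂)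
    (hconcave : 0 ≤ 2 * (b + b₁ + b₂) + (ρ + 1 - n) + 3 * (l - n))
    (hgap₁ : 0 < gap n l ρ b₁) (hgap₂ : 0 < gap n l ρ b₂) : 0 < gap n l ρ b := by
  rcases h₁.eq_or_lt with rfl | h₁
  · exact hgap₁
  have hb : 0 < b₂ - b₁ := by linarith
  -- The remainder of linear interpolation is explicit for a cubic.
  have hchord : gap n l ρ b * (b₂ - b₁) = (b₂ - b) * gap n l ρ b₁ + (b - b₁) * gap n l ρ b₂ +
      (b - b₁) * (b₂ - b) * (b₂ - b₁) * (2 * (b + b₁ + b₂) + (ρ + 1 - n) + 3 * (l - n)) := by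
    unfold gap; ring
  refine pos_of_mul_pos_left ?_ hb.le
  rw [hchord]
  have := sub_nonneg.2 h₂
  have := sub_pos.2 h₁
  positivity

theorem gap_pos_right_endpoint {n l ρ : ℝ} (hl : 0 < l) (hlρ : l < 2 * ρ)
    (h : l * (2 * n - l) < 2 * ρ * (2 * ρ + 2 - l)) : 0 < gap n l ρ (n - l / 2) := by
  have hD : l / 2 * ρ < ρ * (ρ + 1) - l / 2 * (n - l / 2) := by linarith
  have hα : 0 < ρ + 1 - l / 2 := by linarith
  calc 0 < l / 2 * (ρ * (ρ + 1 - l / 2) - l / 2 * (n - l / 2)) :=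
      mul_pos (by linarith) (by linarith)
    _ = (ρ + 1 - l / 2) * (l / 2 * ρ) - (n - l / 2) * (l / 2) ^ 2 := by ring
    _ ≤ (ρ + 1 - l / 2) * (ρ * (ρ + 1) - l / 2 * (n - l / 2)) - (n - l / 2) * (l / 2) ^ 2 := by
      gcongr
    _ = gap n l ρ (n - l / 2) := by unfold gap; ring

theorem gap_pos_of_left_endpoint {n l ρ b b₁ : ℝ} (hb₁ : 0 ≤ b₁) (h₁ : b₁ ≤ b)
    (h₂ : 2 * b + l ≤ 2 * n) (hl : 0 < l) (hlρ : l < 2 * ρ) (hn : 2 * n ≤ ρ + 1 + 2 * l)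
    (hgap₁ : 0 < gap n l ρ b₁) (h : l * (2 * n - l) < 2 * ρ * (2 * ρ + 2 - l)) :
    0 < gap n l ρ b :=
  gap_pos_of_endpoints h₁ (by linarith) (by linarith) hgap₁ (gap_pos_right_endpoint hl hlρ h)

theorem matching_gap_pos {n δ ρ b : ℝ} (hδ : 0 ≤ δ) (hn : 6 * δ + 10 ≤ n)
    (hρ : (δ - 1) / 2 + √(n ^ 2 - (3 * δ + 5) * n + (13 * δ ^ 2 + 23 * δ + 41) / 4) < ρ)
    (hb : δ + 2 ≤ b) (hbn : 2 * b + (n - 1) ≤ 2 * n) :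
    n - 1 < 2 * ρ ∧ 0 < gap n (n - 1) ρ b := by
  have hsqrt := Real.sqrt_nonneg (n ^ 2 - (3 * δ + 5) * n + (13 * δ ^ 2 + 23 * δ + 41) / 4)
  have hsq := (Real.sqrt_lt' (by linarith)).1 (lt_sub_iff_add_lt'.2 hρ)
  -- `q` is the excess of `ρ` over `n - (δ + 2) - 1`, the spectral radius of a clique on the
  -- vertices outside a set of `δ + 2` vertices.
  obtain ⟨z, rfl⟩ : ∃ z, n = 6 * δ + 10 + z := ⟨n - (6 * δ + 10), by ring⟩
  obtain ⟨q, rfl⟩ : ∃ q, ρ = 5 * δ + 7 + z + q := ⟨ρ - (5 * δ + 7 + z), by ring⟩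
  have hz : 0 ≤ z := by linarith
  set R := δ ^ 2 - 7 / 4 * δ + 4 with hR
  have hqP : R < q * (9 * δ + 15 + 2 * z + q) := by linarith
  have hR₀ : 3 < R := by linarith [sq_nonneg (δ - 7 / 8)]
  have hq : 0 < q := pos_of_mul_pos_left (by linarith) (by linarith : 0 ≤ 9 * δ + 15 + 2 * z + q)
  refine ⟨by linarith, gap_pos_of_left_endpoint (b₁ := δ + 2) (by linarith) hb hbn (by linarith)
    (by linarith) (by linarith) ?_ ?_⟩
  · have hP : (δ + 2) * (δ + 1) ^ 2 * (9 * δ + 15 + 2 * z + q) ≤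
        R * (6 * (2 * δ + 3) ^ 2 + (10 * δ + 15) * (z + q) + (z + q) ^ 2) := by
      have h₁ : (δ + 2) * (δ + 1) ^ 2 * (9 * δ + 15) ≤ R * (6 * (2 * δ + 3) ^ 2) := by
        rw [hR]
        linarith [sq_nonneg (δ ^ 2 - 7 / 10 * δ - 3), sq_nonneg δ]
      have h₂ : (δ + 2) * (δ + 1) ^ 2 * 2 ≤ R * (10 * δ + 15) := by
        rw [hR]
        nlinarith [mul_nonneg hδ (sq_nonneg (δ - 1)), sq_nonneg (δ - 1)]
      have h₃ := mul_le_mul_of_nonneg_right h₂ (add_nonneg hz hq.le)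
      have h₄ : 0 ≤ R * (z + q) ^ 2 := by positivity
      have h₅ : 0 ≤ (δ + 2) * (δ + 1) ^ 2 * q := by positivity
      linarith
    have hC := mul_lt_mul_of_pos_left hqP (by positivity : 0 < (δ + 2) * (δ + 1) ^ 2)
    have := mul_le_mul_of_nonneg_left hP hq.le
    refine pos_of_mul_pos_left (b := R) ?_ (by linarith)
    unfold gap
    linarith
  · rw [← sub_pos]
    have h₁ : 0 ≤ q * (5 * δ + 6 + z + q) := by positivity
    have h₂ : 0 ≤ δ * z := by positivity
    linarith [sq_nonneg δ, sq_nonneg z]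

theorem factor_gap_pos {n δ k ρ b : ℝ} (hk : 2 ≤ k) (hδ : 2 * k - 2 ≤ δ)
    (hn : 6 * δ + 4 * k - 3 ≤ n)
    (hρ : (δ - 1) / 2 + √(n ^ 2 - (3 * δ - 4 * k + 11) * n
      + (13 * δ ^ 2 - (32 * k - 94) * δ + 16 * k ^ 2 - 104 * k + 161) / 4) < ρ)
    (hb : δ - 2 * k + 5 ≤ b) (hbn : 2 * b + (n + 2 * k - 4) ≤ 2 * n) :
    n + 2 * k - 4 < 2 * ρ ∧ 0 < gap n (n + 2 * k - 4) ρ b := by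
  have hsqrt := Real.sqrt_nonneg (n ^ 2 - (3 * δ - 4 * k + 11) * n
      + (13 * δ ^ 2 - (32 * k - 94) * δ + 16 * k ^ 2 - 104 * k + 161) / 4)
  have hsq := (Real.sqrt_lt' (by linarith)).1 (lt_sub_iff_add_lt'.2 hρ)
  -- The slacks of the hypotheses are `u`, `s` and `z`, and `q` is the excess of `ρ` over
  -- `n - (3 + s) - 1`, where `3 + s` is the left endpoint `δ - 2 * k + 5`.
  obtain ⟨u, rfl⟩ : ∃ u, k = 2 + u / 2 := ⟨2 * k - 4, by ring⟩
  obtain ⟨s, rfl⟩ : ∃ s, δ = 2 + u + s := ⟨δ - 2 - u, by ring⟩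
  obtain ⟨z, rfl⟩ : ∃ z, n = 17 + 8 * u + 6 * s + z := ⟨n - (17 + 8 * u + 6 * s), by ring⟩
  obtain ⟨q, rfl⟩ : ∃ q, ρ = 13 + 8 * u + 5 * s + z + q :=
    ⟨ρ - (13 + 8 * u + 5 * s + z), by ring⟩
  have hu : 0 ≤ u := by linarith
  have hs : 0 ≤ s := by linarith
  have hz : 0 ≤ z := by linarith
  have hR₀ : 12 ≤ (4 + u + s) * (3 + s) := by nlinarith
  have hqP : (4 + u + s) * (3 + s) < q * (25 + 15 * u + 9 * s + 2 * z + q) := by linarith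
  have hq : 0 < q :=
    pos_of_mul_pos_left (by linarith) (by linarith : 0 ≤ 25 + 15 * u + 9 * s + 2 * z + q)
  refine ⟨by linarith, gap_pos_of_left_endpoint (b₁ := 3 + s) (by linarith) (by linarith) hbn
    (by linarith) (by linarith) (by linarith) ?_ ?_⟩
  · have hQ : (3 + u + s) * (25 + 15 * u + 9 * s + 2 * z + q) ≤
        (13 + 8 * u + 5 * s + z + q) * (13 + 8 * u + 5 * s + z + q + 1)
          - (3 + u + s) * (3 + s) := by
      rw [← sub_nonneg]
      ring_nf
      positivity
    have h₁ := mul_le_mul_of_nonneg_left hQ hq.le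
    have h₂ := mul_lt_mul_of_pos_left hqP (by positivity : 0 < 3 + u + s)
    have h₃ : 0 ≤ (3 + u + s) * (3 + s) := by positivity
    unfold gap
    linarith
  · have h₁ : 0 ≤ q * (49 + 31 * u + 19 * s + 4 * z + 3 * q) := by positivity
    have h₂ : 0 ≤ 49 * u ^ 2 + 4 * s ^ 2 + 38 * (u * s) + 14 * (u * z) + 6 * (s * z) + z ^ 2 := by
      positivity
    linarith

end Estimates

section LargeDegrees

variable {V : Type*} [Fintype V] {G H : SimpleGraph V} [DecidableRel G.Adj] [DecidableRel H.Adj]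
  {B : Finset V}

theorem IsSubeigenvector.exists_lt_degree {ρ : ℝ} {x : V → ℝ} (hx : IsSubeigenvector G ρ x)
    {l : ℕ} (hl : Fintype.card V ≤ l + 1) (hB : B.Nonempty) (hBl : 2 * #B + l ≤ 2 * Fintype.card V)
    (hlρ : l < 2 * ρ) (hgap : 0 < gap (Fintype.card V) l ρ #B) :
    ∃ v ∈ B, #B + l < G.degree v + Fintype.card V := by
  by_contra! hdeg
  obtain ⟨e, he⟩ : ∃ e, e + Fintype.card V = #B + l :=
    ⟨#B + l - Fintype.card V, by have := hB.card_pos; omega⟩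
  have hl' : (Fintype.card V : ℝ) ≤ l + 1 := mod_cast hl
  have hBl' : 2 * (#B : ℝ) + l ≤ 2 * Fintype.card V := mod_cast hBl
  have he' : (e : ℝ) = #B + l - Fintype.card V := eq_sub_of_add_eq (mod_cast he)
  have := hx.card_bound hB (e := e) (fun v hv => by have := hdeg v hv; omega) (by linarith)
    (by linarith)
  rw [he'] at this
  unfold gap at hgap
  linarith

theorem exists_lt_degree_of_matching_bound [DecidableEq V] (hGH : G ≤ H) {δ : ℕ}
    (hn : 6 * δ + 10 ≤ Fintype.card V)
    (hρ : ((δ : ℝ) - 1) / 2 + √((Fintype.card V : ℝ) ^ 2 - (3 * δ + 5) * Fintype.card V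
      + (13 * (δ : ℝ) ^ 2 + 23 * δ + 41) / 4) < spectralRadius G)
    (hδB : δ + 1 < #B) (hB : 2 * #B + (Fintype.card V - 1) ≤ 2 * Fintype.card V) :
    ∃ v ∈ B, #B + (Fintype.card V - 1) < H.degree v + Fintype.card V := by
  have : Nonempty V := Fintype.card_pos_iff.1 (by omega)
  obtain ⟨x, hx⟩ := exists_isSubeigenvector_spectralRadius G
  have hl : ((Fintype.card V - 1 : ℕ) : ℝ) = Fintype.card V - 1 := Nat.cast_pred (by omega)
  have hB' : 2 * (#B : ℝ) + (Fintype.card V - 1 : ℕ) ≤ 2 * Fintype.card V := mod_cast hB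
  rw [hl] at hB'
  obtain ⟨hlρ, hgap⟩ := matching_gap_pos δ.cast_nonneg (mod_cast hn) hρ (mod_cast hδB) hB'
  exact (hx.mono hGH).exists_lt_degree (by omega) (card_pos.1 (by omega)) hB (hl ▸ hlρ)
    (hl ▸ hgap)

theorem exists_lt_degree_of_factor_bound [DecidableEq V] (hGH : G ≤ H) {δ k : ℕ}
    (hk : 2 ≤ k) (hδ : 2 * k - 2 ≤ δ) (hn : 6 * δ + 4 * k - 3 ≤ Fintype.card V)
    (hρ : ((δ : ℝ) - 1) / 2 + √((Fintype.card V : ℝ) ^ 2 - (3 * δ - 4 * k + 11) * Fintype.card V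
      + (13 * (δ : ℝ) ^ 2 - (32 * k - 94) * δ + 16 * (k : ℝ) ^ 2 - 104 * k + 161) / 4)
        < spectralRadius G)
    (hδB : δ + 4 < #B + 2 * k)
    (hB : 2 * #B + (Fintype.card V + 2 * k - 4) ≤ 2 * Fintype.card V) :
    ∃ v ∈ B, #B + (Fintype.card V + 2 * k - 4) < H.degree v + Fintype.card V := by
  have : Nonempty V := Fintype.card_pos_iff.1 (by omega)
  obtain ⟨x, hx⟩ := exists_isSubeigenvector_spectralRadius G
  have hl : ((Fintype.card V + 2 * k - 4 : ℕ) : ℝ) = Fintype.card V + 2 * k - 4 := by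
    push_cast [show 4 ≤ Fintype.card V + 2 * k by omega]; ring
  have hB' : 2 * (#B : ℝ) + (Fintype.card V + 2 * k - 4 : ℕ) ≤ 2 * Fintype.card V := mod_cast hB
  have hδ' : (2 : ℝ) * k ≤ δ + 2 := mod_cast (by omega : 2 * k ≤ δ + 2)
  have hn' : (6 : ℝ) * δ + 4 * k ≤ Fintype.card V + 3 :=
    mod_cast (by omega : 6 * δ + 4 * k ≤ Fintype.card V + 3)
  have hδB' : (δ : ℝ) + 5 ≤ #B + 2 * k := mod_cast hδB
  rw [hl] at hB'
  obtain ⟨hlρ, hgap⟩ := factor_gap_pos (mod_cast hk) (by linarith) (by linarith) hρ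
    (by linarith) hB'
  exact (hx.mono hGH).exists_lt_degree (by omega) (card_pos.1 (by omega)) hB (hl ▸ hlρ)
    (hl ▸ hgap)

end LargeDegrees

open scoped Classical

section DoubleCounting

variable {V : Type*} [Fintype V] {F : SimpleGraph V} {k : ℕ} {P Q : Finset V}

theorem card_mul_eq_sum_card_bipartiteBelow (hQ : ∀ q ∈ Q, F.degree q = k)
    (hQP : ∀ q ∈ Q, ∀ p, F.Adj q p → p ∈ P) :
    #Q * k = ∑ p ∈ P, #(Q.bipartiteBelow F.Adj p) := by
  rw [← sum_card_bipartiteAbove_eq_sum_card_bipartiteBelow, eq_comm]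
  refine sum_const_nat fun q hq => ?_
  rw [← hQ q hq, ← F.card_neighborFinset_eq_degree]
  congr 1
  ext p
  simpa using hQP q hq p

theorem card_bipartiteBelow_adj_le_degree (p : V) : #(Q.bipartiteBelow F.Adj p) ≤ F.degree p := by
  rw [← F.card_neighborFinset_eq_degree]
  exact card_le_card fun q hq => by simpa using ((mem_bipartiteBelow _).1 hq).2.symm

theorem card_le_card_of_neighbors_mem (hk : 0 < k) (hQ : ∀ q ∈ Q, F.degree q = k)
    (hP : ∀ p ∈ P, F.degree p ≤ k) (hQP : ∀ q ∈ Q, ∀ p, F.Adj q p → p ∈ P) : #Q ≤ #P := by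
  refine Nat.le_of_mul_le_mul_right ?_ hk
  rw [card_mul_eq_sum_card_bipartiteBelow hQ hQP]
  exact sum_le_card_nsmul _ _ _ fun p hp => (card_bipartiteBelow_adj_le_degree p).trans (hP p hp)

theorem card_lt_card_of_neighbors_mem (hQ : ∀ q ∈ Q, F.degree q = k)
    (hP : ∀ p ∈ P, F.degree p ≤ k) (hQP : ∀ q ∈ Q, ∀ p, F.Adj q p → p ∈ P) {p r : V}
    (hp : p ∈ P) (hpr : F.Adj p r) (hr : r ∉ Q) : #Q < #P := by
  have hlt : #(Q.bipartiteBelow F.Adj p) < F.degree p := by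
    rw [← F.card_neighborFinset_eq_degree]
    refine card_lt_card (ssubset_iff_of_subset (fun q hq => ?_) |>.2 ⟨r, by simpa, by simp [hr]⟩)
    simpa using ((mem_bipartiteBelow _).1 hq).2.symm
  refine Nat.lt_of_mul_lt_mul_right (a := k) ?_
  rw [card_mul_eq_sum_card_bipartiteBelow hQ hQP, ← smul_eq_mul, ← sum_const]
  exact sum_lt_sum (fun p hp => (card_bipartiteBelow_adj_le_degree p).trans (hP p hp))
    ⟨p, hp, hlt.trans_le (hP p hp)⟩

end DoubleCounting

section Switching

variable {V : Type*}

/-- The graph obtained from `F` by replacing the edge `xy` with the edge `ux`. This moves one unit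
of degree from `y` to `u`. -/
def switch (F : SimpleGraph V) (u x y : V) : SimpleGraph V :=
  (F \ SimpleGraph.edge x y) ⊔ SimpleGraph.edge u x

variable {H F : SimpleGraph V} {u x y z c a b : V}

theorem adj_or_eq_of_switch_adj (h : (switch F u x y).Adj a b) : F.Adj a b ∨ s(a, b) = s(u, x) := by
  simp only [switch, SimpleGraph.sup_adj, SimpleGraph.sdiff_adj, SimpleGraph.edge_adj] at h
  rw [Sym2.eq_iff]
  tauto

theorem switch_adj_of_ne (h : F.Adj a b) (hne : s(a, b) ≠ s(x, y)) : (switch F u x y).Adj a b := by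
  rw [switch, SimpleGraph.sup_adj, SimpleGraph.sdiff_adj, SimpleGraph.edge_adj]
  rw [Ne, Sym2.eq_iff] at hne
  tauto

theorem sdiff_switch_adj (hux : (H \ F).Adj u x) (hxy : F.Adj x y) (hyc : (H \ F).Adj y c) :
    (H \ switch F u x y).Adj y c := by
  refine ⟨hyc.1, fun h => (adj_or_eq_of_switch_adj h).elim hyc.2 fun heq => ?_⟩
  rcases Sym2.eq_iff.1 heq with ⟨rfl, -⟩ | ⟨rfl, -⟩
  · exact hux.2 hxy.symm
  · exact hxy.ne rfl

theorem degree_edge (hne : a ≠ b) (z : V) [Fintype ((SimpleGraph.edge a b).neighborSet z)] :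
    (SimpleGraph.edge a b).degree z = (if z = a then 1 else 0) + (if z = b then 1 else 0) := by
  rw [← SimpleGraph.card_neighborFinset_eq_degree]
  have hN : (SimpleGraph.edge a b).neighborFinset z =
      (if z = a then {b} else ∅) ∪ (if z = b then {a} else ∅) := by
    ext y
    rw [SimpleGraph.mem_neighborFinset, SimpleGraph.edge_adj]
    grind
  rw [hN]
  grind

variable [Finite V]

theorem degree_sup_edge (hne : a ≠ b) (h : ¬ F.Adj a b) (z : V) [Fintype (F.neighborSet z)]
    [Fintype ((F ⊔ SimpleGraph.edge a b).neighborSet z)] :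
    (F ⊔ SimpleGraph.edge a b).degree z =
      F.degree z + (if z = a then 1 else 0) + (if z = b then 1 else 0) := by
  have hdisj : Disjoint F (SimpleGraph.edge a b) := (F.disjoint_edge).2 h
  have : Fintype ((SimpleGraph.edge a b).neighborSet z) := Fintype.ofFinite _
  rw [add_assoc, ← degree_edge hne]
  simp only [← SimpleGraph.card_neighborFinset_eq_degree]
  rw [SimpleGraph.neighborFinset_sup_of_disjoint z hdisj, card_disjUnion]

theorem degree_sdiff_edge (h : F.Adj a b) (z : V) [Fintype (F.neighborSet z)]
    [Fintype ((F \ SimpleGraph.edge a b).neighborSet z)] :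
    (F \ SimpleGraph.edge a b).degree z + (if z = a then 1 else 0) + (if z = b then 1 else 0) =
      F.degree z := by
  have hF : (F \ SimpleGraph.edge a b) ⊔ SimpleGraph.edge a b = F := by
    rw [sdiff_sup_self, SimpleGraph.sup_edge_of_adj _ h]
  have hab : ¬ (F \ SimpleGraph.edge a b).Adj a b := by simp [SimpleGraph.edge_adj, h.ne]
  have : Fintype ((F \ SimpleGraph.edge a b ⊔ SimpleGraph.edge a b).neighborSet z) := by
    rw [hF]; assumption
  rw [← degree_sup_edge h.ne hab]
  congr!

theorem degree_switch (hne : u ≠ x) (hux : ¬ F.Adj u x) (hxy : F.Adj x y) (z : V)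
    [Fintype (F.neighborSet z)] [Fintype ((switch F u x y).neighborSet z)] :
    (switch F u x y).degree z + (if z = y then 1 else 0) =
      F.degree z + (if z = u then 1 else 0) := by
  have : Fintype ((F \ SimpleGraph.edge x y).neighborSet z) := Fintype.ofFinite _
  have hnew : ¬ (F \ SimpleGraph.edge x y).Adj u x := fun h => hux h.1
  have hdel := degree_sdiff_edge hxy z
  let _ : Fintype ((F \ SimpleGraph.edge x y ⊔ SimpleGraph.edge u x).neighborSet z) :=
    inferInstanceAs (Fintype ((switch F u x y).neighborSet z))
  have hadd : (switch F u x y).degree z = (F \ SimpleGraph.edge x y).degree z +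
      (if z = u then 1 else 0) + (if z = x then 1 else 0) := degree_sup_edge hne hnew z
  omega

end Switching

section NearFactors

variable {V : Type*} [Fintype V] {H F : SimpleGraph V} {k : ℕ} {u v x y z c : V}

/-- A spanning subgraph `F` of `H` in which every vertex has degree `k`, except that each of `u`
and `v` lacks one edge (two if `u = v`). -/
structure NearFactor (H F : SimpleGraph V) (k : ℕ) (u v : V) : Prop where
  le : F ≤ H
  degree_add : ∀ z, F.degree z + (if z = u then 1 else 0) + (if z = v then 1 else 0) = k

theorem HasFactor.or_exists_nearFactor (hf : HasFactor (H ⊔ SimpleGraph.edge u v) k) :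
    HasFactor H k ∨ ∃ F, NearFactor H F k u v := by
  obtain ⟨F, hF, hreg⟩ := hf
  by_cases hadj : F.Adj u v
  · refine Or.inr ⟨F \ SimpleGraph.edge u v, ⟨sdiff_le_iff'.2 hF, fun z => ?_⟩⟩
    rw [degree_sdiff_edge hadj]
    exact hreg z
  · exact Or.inl ⟨F, SimpleGraph.sdiff_edge F hadj ▸ sdiff_le_iff'.2 hF, hreg⟩

namespace NearFactor

theorem symm (h : NearFactor H F k u v) : NearFactor H F k v u :=
  ⟨h.le, fun z => by rw [add_right_comm, h.degree_add]⟩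

theorem degree_le (h : NearFactor H F k u v) (z : V) : F.degree z ≤ k := by
  have := h.degree_add z; omega

theorem degree_eq (h : NearFactor H F k u v) (hu : z ≠ u) (hv : z ≠ v) : F.degree z = k := by
  simpa [hu, hv] using h.degree_add z

theorem degree_left (h : NearFactor H F k u v) (huv : u ≠ v) : F.degree u + 1 = k := by
  simpa [huv] using h.degree_add u

theorem hasFactor (h : NearFactor H F k u v) (huv : (H \ F).Adj u v) : HasFactor H k := by
  refine ⟨F ⊔ SimpleGraph.edge u v, sup_le h.le ((SimpleGraph.edge_le_iff H).2 (Or.inr huv.1)),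
    fun z => ?_⟩
  rw [← h.degree_add z, ← degree_sup_edge huv.1.ne huv.2 z]
  congr!

theorem switch (h : NearFactor H F k u v) (hux : (H \ F).Adj u x) (hxy : F.Adj x y) :
    NearFactor H (switch F u x y) k y v := by
  refine ⟨sup_le (sdiff_le.trans h.le) ((SimpleGraph.edge_le_iff H).2 (Or.inr hux.1)), fun z => ?_⟩
  have hdeg := degree_switch hux.1.ne hux.2 hxy z
  have hz := h.degree_add z
  omega

theorem hasFactor_of_switch (h : NearFactor H F k u v) (hux : (H \ F).Adj u x) (hxy : F.Adj x y)
    (hyv : (H \ F).Adj y v) : HasFactor H k :=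
  (h.switch hux hxy).hasFactor (sdiff_switch_adj hux hxy hyv)

theorem switch_switch (h : NearFactor H F k u v) (hux : (H \ F).Adj u x) (hxy : F.Adj x y)
    (hyc : (H \ F).Adj y c) (hcz : F.Adj c z) :
    NearFactor H (FactorSpectral.switch (FactorSpectral.switch F u x y) y c z) k z v := by
  refine (h.switch hux hxy).switch (sdiff_switch_adj hux hxy hyc) (switch_adj_of_ne hcz ?_)
  intro heq
  rcases Sym2.eq_iff.1 heq with ⟨rfl, rfl⟩ | ⟨rfl, -⟩
  · exact hyc.2 hcz.symm
  · exact hyc.ne rfl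

theorem hasFactor_of_switch_switch (h : NearFactor H F k u v) (huv : u ≠ v)
    (hux : (H \ F).Adj u x) (hxy : F.Adj x y) (hyc : (H \ F).Adj y c) (hcz : F.Adj c z)
    (hzv : (H \ F).Adj z v) : HasFactor H k := by
  by_cases hu : (H \ F).Adj u v
  · exact h.hasFactor hu
  refine (h.switch_switch hux hxy hyc hcz).hasFactor ⟨hzv.1, fun hadj => ?_⟩
  rcases adj_or_eq_of_switch_adj hadj with hadj | heq
  · rcases adj_or_eq_of_switch_adj hadj with hadj | heq
    · exact hzv.2 hadj
    · rcases Sym2.eq_iff.1 heq with ⟨-, rfl⟩ | ⟨-, rfl⟩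
      · exact hu hux
      · exact huv rfl
  · rcases Sym2.eq_iff.1 heq with ⟨rfl, rfl⟩ | ⟨rfl, -⟩
    · exact hyc.2 hcz.symm
    · exact hcz.ne rfl

end NearFactor
end NearFactors

section ClosureStability

variable {V : Type*} [Fintype V] {H F : SimpleGraph V} {k l : ℕ} {u v p q : V}

/-- The common neighbours of `u` and `v` in `H \ F`, the graph of edges that can still be added
to `F`. -/
noncomputable def commonSpare (H F : SimpleGraph V) (u v : V) : Finset V :=
  (H \ F).neighborFinset u ∩ (H \ F).neighborFinset v

/-- The vertices other than `u` and `v` that are adjacent in `H \ F` to neither of them. -/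
noncomputable def noSpare (H F : SimpleGraph V) (u v : V) : Finset V :=
  ({u, v} ∪ ((H \ F).neighborFinset u ∪ (H \ F).neighborFinset v))ᶜ

theorem mem_commonSpare : q ∈ commonSpare H F u v ↔ (H \ F).Adj u q ∧ (H \ F).Adj v q := by
  simp only [commonSpare, mem_inter, SimpleGraph.mem_neighborFinset]

theorem mem_noSpare :
    p ∈ noSpare H F u v ↔ p ≠ u ∧ p ≠ v ∧ ¬ (H \ F).Adj u p ∧ ¬ (H \ F).Adj v p := by
  simp only [noSpare, mem_compl, mem_union, mem_insert, mem_singleton,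
    SimpleGraph.mem_neighborFinset, not_or, and_assoc]

theorem degree_sdiff_add_degree (h : F ≤ H) (z : V) :
    (H \ F).degree z + F.degree z = H.degree z := by
  simp only [← SimpleGraph.card_neighborFinset_eq_degree, SimpleGraph.neighborFinset_sdiff]
  exact card_sdiff_add_card_eq_card fun y hy => by simpa using h (by simpa using hy)

theorem card_noSpare_add (huv : u ≠ v) (hadj : ¬ (H \ F).Adj u v) :
    #(noSpare H F u v) + ((H \ F).degree u + (H \ F).degree v + 2) =
      Fintype.card V + #(commonSpare H F u v) := by
  have hdisj : Disjoint {u, v} ((H \ F).neighborFinset u ∪ (H \ F).neighborFinset v) := by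
    have hadj' := fun h => hadj (SimpleGraph.adj_symm _ h)
    simp only [disjoint_insert_left, disjoint_singleton_left, mem_union,
      SimpleGraph.mem_neighborFinset, SimpleGraph.irrefl, not_or, not_false_eq_true, true_and,
      and_true]
    exact ⟨hadj', hadj⟩
  have hcompl := card_compl_add_card
    ({u, v} ∪ ((H \ F).neighborFinset u ∪ (H \ F).neighborFinset v))
  have hunion := card_union_add_card_inter ((H \ F).neighborFinset u) ((H \ F).neighborFinset v)
  rw [card_union_of_disjoint hdisj, card_pair huv] at hcompl
  simp only [SimpleGraph.card_neighborFinset_eq_degree] at hunion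
  rw [noSpare, commonSpare]
  omega

namespace NearFactor

theorem degree_sdiff_left_add (h : NearFactor H F k u v) (huv : u ≠ v) :
    (H \ F).degree u + k = H.degree u + 1 := by
  have := degree_sdiff_add_degree h.le u
  have := h.degree_left huv
  omega

theorem degree_of_mem_commonSpare (h : NearFactor H F k u v) (hq : q ∈ commonSpare H F u v) :
    F.degree q = k := by
  rw [mem_commonSpare] at hq
  exact h.degree_eq hq.1.ne' hq.2.ne'

theorem mem_noSpare_of_adj (h : NearFactor H F k u v) (hno : ¬ HasFactor H k)
    (hq : q ∈ commonSpare H F u v) (hqp : F.Adj q p) : p ∈ noSpare H F u v := by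
  rw [mem_commonSpare] at hq
  rw [mem_noSpare]
  refine ⟨?_, ?_, fun hp => hno (h.hasFactor_of_switch hp hqp.symm hq.2.symm),
    fun hp => hno (h.hasFactor_of_switch hq.1 hqp hp.symm)⟩
  · rintro rfl
    exact hq.1.2 hqp.symm
  · rintro rfl
    exact hq.2.2 hqp.symm

theorem card_commonSpare_le (h : NearFactor H F k u v) (hk : 0 < k) (hno : ¬ HasFactor H k) :
    #(commonSpare H F u v) ≤ #(noSpare H F u v) :=
  card_le_card_of_neighbors_mem hk (fun _ => h.degree_of_mem_commonSpare)
    (fun p _ => h.degree_le p) fun _ hq _ => h.mem_noSpare_of_adj hno hq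

theorem mem_commonSpare_of_adj (h : NearFactor H F k u v) (hno : ¬ HasFactor H k)
    (hcard : #(noSpare H F u v) ≤ #(commonSpare H F u v)) (hp : p ∈ noSpare H F u v)
    (hpq : F.Adj p q) : q ∈ commonSpare H F u v := by
  by_contra hq
  exact hcard.not_gt <| card_lt_card_of_neighbors_mem (fun _ => h.degree_of_mem_commonSpare)
    (fun p _ => h.degree_le p) (fun _ hq _ => h.mem_noSpare_of_adj hno hq) hp hpq hq

/-- If the double count is tight, the `F`-neighbours of `u` are spare at `v` and conversely, and
`u x₁ x₂ u y₁ v` is an augmenting trail, where `x₁` is an `F`-neighbour of `v`, `x₂` another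
`F`-neighbour of `x₁` and `y₁` an `F`-neighbour of `u`. -/
theorem hasFactor_of_card_noSpare_le (h : NearFactor H F k u v) (huv : u ≠ v)
    (hadj : ¬ H.Adj u v) (hk : 2 ≤ k) (hcard : #(noSpare H F u v) ≤ #(commonSpare H F u v)) :
    HasFactor H k := by
  by_contra hno
  have hcommon {p q} (hp : p ∈ noSpare H F u v) (hpq : F.Adj p q) :
      (H \ F).Adj u q ∧ (H \ F).Adj v q :=
    mem_commonSpare.1 (h.mem_commonSpare_of_adj hno hcard hp hpq)
  have hFu {y} (hy : F.Adj u y) : (H \ F).Adj v y := by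
    by_contra hvy
    have hyv : y ≠ v := by
      rintro rfl
      exact hadj (h.le hy)
    exact (hcommon (mem_noSpare.2 ⟨hy.ne', hyv, fun huy => huy.2 hy, hvy⟩) hy.symm).1.ne rfl
  have hFv {x} (hx : F.Adj v x) : (H \ F).Adj u x := by
    by_contra hux
    have hxu : x ≠ u := by
      rintro rfl
      exact hadj (h.le hx).symm
    exact (hcommon (mem_noSpare.2 ⟨hxu, hx.ne', hux, fun hvx => hvx.2 hx⟩) hx.symm).2.ne rfl
  obtain ⟨y₁, huy₁⟩ := (F.degree_pos_iff_exists_adj u).1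
    (by have := h.degree_left huv; omega)
  obtain ⟨x₁, hvx₁⟩ := (F.degree_pos_iff_exists_adj v).1
    (by have := h.symm.degree_left huv.symm; omega)
  have hx₁ : (H \ F).Adj u x₁ := hFv hvx₁
  obtain ⟨x₂, hx₁₂, hx₂v⟩ : ∃ x₂ ∈ F.neighborFinset x₁, x₂ ≠ v :=
    exists_mem_ne (by rw [F.card_neighborFinset_eq_degree, h.degree_eq hx₁.ne' hvx₁.ne']; omega) v
  rw [SimpleGraph.mem_neighborFinset] at hx₁₂
  have hx₂ : (H \ F).Adj u x₂ := by
    by_contra hux₂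
    refine (hcommon (mem_noSpare.2 ⟨?_, hx₂v, hux₂, fun hvx₂ => ?_⟩) hx₁₂.symm).2.2 hvx₁
    · rintro rfl
      exact hx₁.2 hx₁₂.symm
    · exact hno (h.hasFactor_of_switch hx₁ hx₁₂ hvx₂.symm)
  exact hno (h.hasFactor_of_switch_switch huv hx₁ hx₁₂ hx₂.symm huy₁ (hFu huy₁).symm)

theorem hasFactor_of_degree_add (h : NearFactor H F k u v) (huv : u ≠ v) (hadj : ¬ H.Adj u v)
    (hdeg : Fintype.card V + 2 * k ≤ H.degree u + H.degree v + 2 + min k 2) : HasFactor H k := by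
  by_contra hno
  have hk := h.degree_left huv
  have hle := h.card_commonSpare_le (by omega) hno
  have hcard := card_noSpare_add huv fun hsp : (H \ F).Adj u v => hadj hsp.1
  have hu := h.degree_sdiff_left_add huv
  have hv := h.symm.degree_sdiff_left_add huv.symm
  exact hno (h.hasFactor_of_card_noSpare_le huv hadj (by omega) (by omega))

end NearFactor

/-- The term `min k 2` is a device to cover both thresholds of the theorem: `l = n - 1` for `k = 1`
and `l = n + 2 * k - 4` for `2 ≤ k`. -/
theorem HasFactor.of_reflTransGen {G : SimpleGraph V}
    (hl : Fintype.card V + 2 * k ≤ l + 2 + min k 2)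
    (h : Relation.ReflTransGen (ClosureStep l) G H) (hf : HasFactor H k) : HasFactor G k := by
  induction h using Relation.ReflTransGen.head_induction_on with
  | refl => exact hf
  | head hstep _ ih =>
    obtain ⟨u, v, huv, hadj, hdeg, rfl⟩ := hstep
    obtain hG | ⟨F, hF⟩ := ih.or_exists_nearFactor
    · exact hG
    · exact hF.hasFactor_of_degree_add huv hadj (by omega)

end ClosureStability

section CompleteGraphs

theorem exists_nat_finset_sub_mem {n k : ℕ} (hk : k < n) (h : Even (n * k)) :
    ∃ S : Finset ℕ, #S = k ∧ ∀ i ∈ S, 0 < i ∧ i < n ∧ n - i ∈ S := by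
  obtain hodd | heven := (Nat.even_or_odd (n + k)).symm
  · refine ⟨Icc ((n - k + 1) / 2) ((n + k - 1) / 2), ?_, fun i hi => ?_⟩
    · grind [Nat.card_Icc]
    · grind
  · have hn : Even n := by grind
    refine ⟨(Icc ((n - k) / 2) ((n + k) / 2)).erase (n / 2), ?_, fun i hi => ?_⟩
    · rw [card_erase_of_mem (by grind), Nat.card_Icc]
      grind
    · grind

theorem exists_finset_neg_mem {n k : ℕ} [NeZero n] (hk : k < n) (h : Even (n * k)) :
    ∃ T : Finset (ZMod n), #T = k ∧ 0 ∉ T ∧ ∀ z ∈ T, -z ∈ T := by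
  obtain ⟨S, hcard, hS⟩ := exists_nat_finset_sub_mem hk h
  have h0 : (0 : ZMod n) ∉ univ.filter fun z : ZMod n => z.val ∈ S := by
    simpa using fun hz => (hS 0 hz).1
  refine ⟨univ.filter fun z => z.val ∈ S, ?_, h0, fun z hz => ?_⟩
  · rw [← hcard]
    refine card_nbij ZMod.val (fun z hz => by simpa using hz)
      (ZMod.val_injective n).injOn fun i hi => ?_
    exact ⟨i, by simpa [ZMod.val_cast_of_lt (hS i hi).2.1] using hi,
      ZMod.val_cast_of_lt (hS i hi).2.1⟩
  · have hz0 : z ≠ 0 := fun hz0 => h0 (hz0 ▸ hz)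
    simpa [ZMod.neg_val, hz0] using (hS _ (mem_filter.1 hz).2).2.2

variable {V : Type*} [Fintype V] {k : ℕ}

theorem hasFactor_top (hk : k < Fintype.card V) (h : Even (Fintype.card V * k)) :
    HasFactor (⊤ : SimpleGraph V) k := by
  have : NeZero (Fintype.card V) := ⟨by omega⟩
  obtain ⟨T, hcard, h0, hneg⟩ := exists_finset_neg_mem hk h
  let e : V ≃ ZMod (Fintype.card V) := Fintype.equivOfCardEq (ZMod.card _).symm
  let F : SimpleGraph V :=
    { Adj := fun u v => e u - e v ∈ T
      symm := ⟨fun u v huv => by simpa using hneg _ huv⟩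
      loopless := ⟨fun u hu => h0 (by simpa using hu)⟩ }
  refine ⟨F, le_top, fun u => ?_⟩
  rw [← SimpleGraph.card_neighborFinset_eq_degree, ← hcard]
  refine card_nbij (fun v => e u - e v) (fun v hv => by simpa [F] using hv)
    (fun v _ v' _ hvv => e.injective (sub_right_injective hvv)) fun z hz => ?_
  exact ⟨e.symm (e u - z), by simpa [F] using hz, by simp⟩

end CompleteGraphs

section NearCliques

variable {V : Type*} [Fintype V] {H K : SimpleGraph V} {k l δ : ℕ} {B : Finset V} {b b' w : V}

/-- Nonadjacent vertices have degree sum less than `l`, that is, the `l`-closure process stops. -/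
def IsDegreeSumClosed (l : ℕ) (H : SimpleGraph V) : Prop :=
  ∀ u v, u ≠ v → ¬ H.Adj u v → H.degree u + H.degree v < l

theorem IsClosure.isDegreeSumClosed (h : IsClosure l H K) : IsDegreeSumClosed l K :=
  fun u v huv hadj => not_le.1 fun hl => h.2 _ ⟨u, v, huv, hadj, hl, rfl⟩

theorem IsClosure.le (h : IsClosure l H K) : H ≤ K := by
  have hsteps := h.1
  clear h
  induction hsteps with
  | refl => exact le_rfl
  | tail _ hstep ih => exact ih.trans hstep.lt.le

theorem degree_add_card_of_isClique_compl (hclique : H.IsClique (B : Set V)ᶜ) (hw : w ∉ B) :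
    H.degree w + #B + 1 = #(H.neighborFinset w ∩ B) + Fintype.card V := by
  have hsdiff : H.neighborFinset w \ B = Bᶜ.erase w := by
    ext z
    simp only [mem_sdiff, SimpleGraph.mem_neighborFinset, mem_erase, mem_compl]
    exact ⟨fun h => ⟨h.1.ne', h.2⟩,
      fun h => ⟨hclique (by simpa using hw) (by simpa using h.2) h.1.symm, h.2⟩⟩
  have hcard := card_inter_add_card_sdiff (H.neighborFinset w) B
  have herase := card_erase_add_one (mem_compl.2 hw)
  have hcompl := card_compl_add_card B
  rw [hsdiff, SimpleGraph.card_neighborFinset_eq_degree] at hcard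
  omega

theorem IsDegreeSumClosed.degree_add_card_inter_le (hc : IsDegreeSumClosed l H)
    (hclique : H.IsClique (B : Set V)ᶜ) (hb : b ∈ B) (hw : w ∉ B) (hbw : ¬ H.Adj b w) :
    H.degree b + #(H.neighborFinset w ∩ B) + Fintype.card V ≤ l + #B := by
  have hsum := hc b w (fun h => hw (h ▸ hb)) hbw
  have hdeg := degree_add_card_of_isClique_compl hclique hw
  omega

theorem card_le_degree_add_card (hadj : ∀ w ∉ B, H.Adj b w) : Fintype.card V ≤ H.degree b + #B := by
  rw [← card_compl_add_card B, add_le_add_iff_right, ← SimpleGraph.card_neighborFinset_eq_degree]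
  exact card_le_card fun w hw => by simpa using hadj w (mem_compl.1 hw)

/-- In a graph `H` of minimum degree at least `δ` in which the `l`-closure process stops, all but
at most `card V + δ - l` vertices form a clique; `B` is the set of the exceptional vertices. -/
structure IsNearClique (l δ : ℕ) (H : SimpleGraph V) (B : Finset V) : Prop where
  closed : IsDegreeSumClosed l H
  le_degree : ∀ v, δ ≤ H.degree v
  isClique : H.IsClique (B : Set V)ᶜ
  card_le : l + #B ≤ Fintype.card V + δ

/-- The exceptional vertices are those of degree less than `l / 2`. If there were too many of them,
all of them, or just `card V - l / 2` of them, would contradict `hdeg`. -/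
theorem IsDegreeSumClosed.exists_isNearClique (hc : IsDegreeSumClosed l H)
    (hδ : ∀ v, δ ≤ H.degree v) (hδl : 2 * δ + 2 ≤ l) (hl : l ≤ 2 * Fintype.card V)
    (hdeg : ∀ B : Finset V, Fintype.card V + δ < l + #B → 2 * #B + l ≤ 2 * Fintype.card V →
      ∃ v ∈ B, #B + l < H.degree v + Fintype.card V) :
    ∃ B, IsNearClique l δ H B := by
  let B : Finset V := {v | 2 * H.degree v < l}
  have hlow {v} (hv : v ∈ B) : 2 * H.degree v < l := (mem_filter.1 hv).2
  have hclique : H.IsClique (B : Set V)ᶜ := by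
    intro u hu v hv huv
    by_contra hadj
    have hsum := hc u v huv hadj
    simp only [B, coe_filter, mem_univ, true_and, Set.mem_compl_iff, Set.mem_ofPred_eq] at hu hv
    omega
  refine ⟨B, hc, hδ, hclique, ?_⟩
  by_contra! hlarge
  by_cases hB : 2 * #B + l ≤ 2 * Fintype.card V
  · obtain ⟨v, hv, hv'⟩ := hdeg B hlarge hB
    have hvlow := hlow hv
    by_cases hadj : ∀ w ∉ B, H.Adj v w
    · have := card_le_degree_add_card hadj
      omega
    · push Not at hadj
      obtain ⟨w, hw, hvw⟩ := hadj
      have := hc.degree_add_card_inter_le hclique hv hw hvw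
      omega
  · obtain ⟨B₀, hB₀, hcard⟩ := exists_subset_card_eq
      (show (2 * Fintype.card V - l) / 2 ≤ #B by omega)
    obtain ⟨v, hv, hv'⟩ := hdeg B₀ (by omega) (by omega)
    have := hlow (hB₀ hv)
    omega

namespace IsNearClique

theorem mono (h : IsNearClique l δ H B) (hHK : H ≤ K) (hK : IsDegreeSumClosed l K) :
    IsNearClique l δ K B where
  closed := hK
  le_degree v := (h.le_degree v).trans (SimpleGraph.degree_le_of_le hHK)
  isClique := h.isClique.mono hHK
  card_le := h.card_le

theorem card_eq_of_not_adj (h : IsNearClique l δ H B) (hb : b ∈ B) (hw : w ∉ B)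
    (hbw : ¬ H.Adj b w) : l + #B = Fintype.card V + δ := by
  have hle := h.closed.degree_add_card_inter_le h.isClique hb hw hbw
  have hδ := h.le_degree b
  have hcard := h.card_le
  omega

theorem not_adj_of_not_adj (h : IsNearClique l δ H B) (hb : b ∈ B) (hw : w ∉ B)
    (hbw : ¬ H.Adj b w) (hb' : b' ∈ B) : ¬ H.Adj b' w := by
  intro hadj
  have hpos : 0 < #(H.neighborFinset w ∩ B) := card_pos.2 ⟨b', by simpa [hb'] using hadj.symm⟩
  have hle := h.closed.degree_add_card_inter_le h.isClique hb hw hbw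
  have hδ := h.le_degree b
  have hcard := h.card_le
  omega

theorem adj_of_adj (h : IsNearClique l δ H B) (hb : b ∈ B) (hw : w ∉ B) (hbw : H.Adj b w)
    (hb' : b' ∈ B) : H.Adj b' w :=
  by_contra fun hn => h.not_adj_of_not_adj hb' hw hn hb hbw

theorem degree_eq_of_not_adj (h : IsNearClique l δ H B) (hb : b ∈ B) (hw : w ∉ B)
    (hbw : ¬ H.Adj b w) (hb' : b' ∈ B) : H.degree b' = δ := by
  have hle := h.closed.degree_add_card_inter_le h.isClique hb' hw
    (h.not_adj_of_not_adj hb hw hbw hb')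
  have hδ := h.le_degree b'
  have hcard := h.card_le
  omega

theorem eq_top_of_forall_adj (h : IsNearClique l δ H B) (hl : 2 * δ ≤ l)
    (hadj : ∀ b ∈ B, ∀ w ∉ B, H.Adj b w) : H = ⊤ := by
  refine SimpleGraph.eq_top_iff_forall_ne_adj.2 fun u v huv => ?_
  by_cases hu : u ∈ B <;> by_cases hv : v ∈ B
  · by_contra huv'
    have hsum := h.closed u v huv huv'
    have hdu := card_le_degree_add_card (hadj u hu)
    have hdv := card_le_degree_add_card (hadj v hv)
    have hcard := h.card_le
    omega
  · exact hadj u hu v hv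
  · exact (hadj v hv u hu).symm
  · exact h.isClique (by simpa using hu) (by simpa using hv) huv

theorem eq_top_of_lt_degree (h : IsNearClique l δ H B) (hl : 2 * δ ≤ l) (hb : b ∈ B)
    (hdeg : δ < H.degree b) : H = ⊤ :=
  h.eq_top_of_forall_adj hl fun _ hb' _ hw => by_contra fun hn =>
    hdeg.ne' (h.degree_eq_of_not_adj hb' hw hn hb)

theorem hasFactor_sup_edge (h : IsNearClique l δ H B) (hl : 2 * δ ≤ l) (hb : b ∈ B) (hbw : b ≠ w)
    (hadj : ¬ H.Adj b w) (hk : k < Fintype.card V) (heven : Even (Fintype.card V * k))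
    (hkl : Fintype.card V + 2 * k ≤ l + 2 + min k 2) : HasFactor (H ⊔ SimpleGraph.edge b w) k := by
  obtain ⟨K, hK⟩ := exists_isClosure l (H ⊔ SimpleGraph.edge b w)
  have hdeg : δ < K.degree b := calc
    δ < H.degree b + 1 := Nat.lt_succ_of_le (h.le_degree b)
    _ = (H ⊔ SimpleGraph.edge b w).degree b := by rw [degree_sup_edge hbw hadj]; simp [hbw]
    _ ≤ K.degree b := SimpleGraph.degree_le_of_le hK.le
  have htop : K = ⊤ :=
    (h.mono (le_sup_left.trans hK.le) hK.isDegreeSumClosed).eq_top_of_lt_degree hl hb hdeg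
  exact HasFactor.of_reflTransGen hkl hK.1 (htop ▸ hasFactor_top hk heven)

theorem hasFactor_or_exists_nearFactor (h : IsNearClique l δ H B) (hl : 2 * δ ≤ l)
    (hk : k < Fintype.card V) (heven : Even (Fintype.card V * k))
    (hkl : Fintype.card V + 2 * k ≤ l + 2 + min k 2) :
    HasFactor H k ∨ ∃ b ∈ B, ∃ w ∉ B, ¬ H.Adj b w ∧ ∃ F, NearFactor H F k b w := by
  by_cases hadj : ∀ b ∈ B, ∀ w ∉ B, H.Adj b w
  · exact Or.inl (h.eq_top_of_forall_adj hl hadj ▸ hasFactor_top hk heven)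
  · push Not at hadj
    obtain ⟨b, hb, w, hw, hbw⟩ := hadj
    have hne : b ≠ w := fun hbw => hw (hbw ▸ hb)
    exact (h.hasFactor_sup_edge hl hb hne hbw hk heven hkl).or_exists_nearFactor.imp_right
      fun hF => ⟨b, hb, w, hw, hbw, hF⟩

end IsNearClique
end NearCliques

section Completion

variable {V : Type*} [Fintype V] {H F : SimpleGraph V} {k l δ : ℕ} {B : Finset V}
  {b w u v x y z s : V}

theorem even_card_of_forall_degree_eq_one {S : Finset V} (hdeg : ∀ s ∈ S, F.degree s = 1)
    (hS : ∀ s ∈ S, ∀ x, F.Adj s x → x ∈ S) : Even #S := by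
  let M : F.Subgraph := (⊤ : F.Subgraph).induce S
  have hM : M.IsMatching := fun s hs => by
    obtain ⟨x, hsx, hx⟩ := SimpleGraph.degree_eq_one_iff_existsUnique_adj.1 (hdeg s hs)
    exact ⟨x, ⟨hs, hS s hs x hsx, hsx⟩, fun y hy => hx y hy.2.2⟩
  convert hM.even_card
  simp [M]

namespace NearFactor

theorem exists_adj (h : NearFactor H F k u v) (hk : 0 < k) (hu : z ≠ u)
    (hv : z ≠ v) : ∃ x, F.Adj z x :=
  (F.degree_pos_iff_exists_adj z).1 ((h.degree_eq hu hv).symm ▸ hk)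

theorem hasFactor_of_isClique (h : NearFactor H F k y w) (hk : 0 < k)
    (hclique : H.IsClique (B : Set V)ᶜ) (hn : 2 * #B + 2 * k + 4 < Fintype.card V)
    (hy : y ∉ B) (hw : w ∉ B) : HasFactor H k := by
  set X := (B ∪ ({y, w} ∪ F.neighborFinset y))ᶜ with hX
  set Z := B ∪ ({y, w} ∪ F.neighborFinset w) with hZ
  have hpair : #({y, w} : Finset V) ≤ 2 := card_le_two
  have hcardX : Fintype.card V ≤ #X + (#B + (2 + k)) := by
    rw [← card_compl_add_card Xᶜ, compl_compl, add_le_add_iff_left, hX, compl_compl]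
    exact (card_union_le _ _).trans (Nat.add_le_add_left
      ((card_union_le _ _).trans (Nat.add_le_add hpair (h.degree_le y))) _)
  have hcardZ : #Z ≤ #B + (2 + k) := (card_union_le _ _).trans (Nat.add_le_add_left
    ((card_union_le _ _).trans (Nat.add_le_add hpair (h.degree_le w))) _)
  obtain ⟨p, hp, q, hpq, hq⟩ : ∃ p ∈ X, ∃ q, F.Adj p q ∧ q ∉ Z := by
    by_contra! hcon
    have hle := card_le_card_of_neighbors_mem hk (Q := X) (P := Z) (F := F) (fun p hp => ?_)
      (fun q _ => h.degree_le q) hcon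
    · omega
    · simp only [hX, mem_compl, mem_union, mem_insert, mem_singleton, not_or] at hp
      exact h.degree_eq hp.2.1.1 hp.2.1.2
  simp only [hX, hZ, mem_compl, mem_union, mem_insert, mem_singleton, not_or,
    SimpleGraph.mem_neighborFinset] at hp hq
  have hyp : (H \ F).Adj y p :=
    ⟨hclique (by simpa using hy) (by simpa using hp.1) (Ne.symm hp.2.1.1), hp.2.2⟩
  have hqw : (H \ F).Adj q w :=
    ⟨hclique (by simpa using hq.1) (by simpa using hw) hq.2.1.2, fun h => hq.2.2 h.symm⟩
  exact h.hasFactor_of_switch hyp hpq hqw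

theorem mem_erase_of_adj (h : NearFactor H F k b w) (hno : ¬ HasFactor H k) (hk : 0 < k)
    (hclique : H.IsClique (B : Set V)ᶜ) (hn : 2 * #B + 2 * k + 4 < Fintype.card V) (hw : w ∉ B)
    (hbz : (H \ F).Adj b z) (hzx : F.Adj z x) : x ∈ B.erase b := by
  refine mem_erase.2 ⟨fun hxb => hbz.2 (hxb ▸ hzx.symm), by_contra fun hx => hno ?_⟩
  exact (h.switch hbz hzx).hasFactor_of_isClique hk hclique hn hx hw

theorem sdiff_adj_of_adj (h : NearFactor H F k b w) (hno : ¬ HasFactor H k) (hk : 0 < k)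
    (hclique : H.IsClique (B : Set V)ᶜ) (hn : 2 * #B + 2 * k + 4 < Fintype.card V) (hb : b ∈ B)
    (hw : w ∉ B) (hbw : ¬ H.Adj b w) (hcard : #B + k ≤ H.degree b + 2) (hx : x ∈ B.erase b)
    (hxz : F.Adj x z) : (H \ F).Adj b z := by
  by_contra hbz
  have hlt := card_lt_card_of_neighbors_mem (F := F) (k := k) (Q := (H \ F).neighborFinset b)
    (P := B.erase b) (fun a ha => ?_) (fun p _ => h.degree_le p) (fun a ha p => ?_) hx hxz
    (by simpa using hbz)
  · have hne : b ≠ w := fun hbw => hw (hbw ▸ hb)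
    have hdeg := h.degree_sdiff_left_add hne
    have herase := card_erase_add_one hb
    rw [SimpleGraph.card_neighborFinset_eq_degree] at hlt
    omega
  · rw [SimpleGraph.mem_neighborFinset] at ha
    exact h.degree_eq ha.1.ne' fun haw => hbw (haw ▸ ha.1)
  · exact h.mem_erase_of_adj hno hk hclique hn hw (by simpa using ha)

/-- The augmenting trail is `b a x s y`, where `a` is spare at `b`, `x ∈ B` is an `F`-neighbour
of `a`, `s` an `F`-neighbour of `b` and `y` another `F`-neighbour of `s`. It ends in the clique. -/
theorem hasFactor_of_two_le (h : NearFactor H F k b w) (hk : 2 ≤ k) (hB : IsNearClique l δ H B)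
    (hn : 2 * #B + 2 * k + 4 < Fintype.card V) (hb : b ∈ B) (hw : w ∉ B) (hbw : ¬ H.Adj b w)
    (hcard : #B + k ≤ H.degree b + 2) (hkb : k ≤ H.degree b) : HasFactor H k := by
  by_contra hno
  have hk0 : 0 < k := by omega
  have hne : b ≠ w := fun hbw => hw (hbw ▸ hb)
  have hmem {z x} : (H \ F).Adj b z → F.Adj z x → x ∈ B.erase b :=
    h.mem_erase_of_adj hno hk0 hB.isClique hn hw
  have hspare {x z} : x ∈ B.erase b → F.Adj x z → (H \ F).Adj b z :=
    h.sdiff_adj_of_adj hno hk0 hB.isClique hn hb hw hbw hcard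
  obtain ⟨s, hbs⟩ := (F.degree_pos_iff_exists_adj b).1 (by have := h.degree_left hne; omega)
  have hsB : s ∉ B := fun hs => (hspare (mem_erase.2 ⟨hbs.ne', hs⟩) hbs.symm).ne rfl
  have hsw : s ≠ w := fun hsw => hbw (hsw ▸ h.le hbs)
  obtain ⟨y, hsy, hyb⟩ : ∃ y ∈ F.neighborFinset s, y ≠ b :=
    exists_mem_ne (by rw [F.card_neighborFinset_eq_degree, h.degree_eq hbs.ne' hsw]; omega) b
  rw [SimpleGraph.mem_neighborFinset] at hsy
  have hyB : y ∉ B := fun hy => (hspare (mem_erase.2 ⟨hyb, hy⟩) hsy.symm).2 hbs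
  obtain ⟨a, hba⟩ := ((H \ F).degree_pos_iff_exists_adj b).1
    (by have := h.degree_sdiff_left_add hne; omega)
  obtain ⟨x, hax⟩ := h.exists_adj hk0 hba.ne' fun haw => hbw (haw ▸ hba.1)
  have hx := hmem hba hax
  have hxs : (H \ F).Adj x s :=
    ⟨hB.adj_of_adj hb hsB (h.le hbs) (mem_of_mem_erase hx), fun hxs => (hspare hx hxs).2 hbs⟩
  exact hno <| (h.switch_switch hba hax hxs hsy).hasFactor_of_isClique hk0 hB.isClique hn hyB hw

end NearFactor

theorem eq_of_adj_of_degree_le_one (hdeg : F.degree z ≤ 1) (hx : F.Adj z x) (hy : F.Adj z y) :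
    x = y := by
  rw [← F.card_neighborFinset_eq_degree, card_le_one] at hdeg
  exact hdeg x (by simpa using hx) y (by simpa using hy)

namespace NearFactor

theorem sdiff_adj_left_iff (h : NearFactor H F 1 b w) (hne : b ≠ w) :
    (H \ F).Adj b z ↔ H.Adj b z := by
  refine ⟨fun hbz => hbz.1, fun hbz => ⟨hbz, fun hF => ?_⟩⟩
  have hpos := (F.degree_pos_iff_exists_adj b).2 ⟨z, hF⟩
  have hdeg := h.degree_left hne
  omega

theorem even_degree (h : NearFactor H F 1 b w) (hno : ¬ HasFactor H 1)
    (hclique : H.IsClique (B : Set V)ᶜ) (hn : 2 * #B + 6 < Fintype.card V) (hb : b ∈ B)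
    (hw : w ∉ B) (hcard : #B ≤ H.degree b + 1) (hbB : ∀ z, H.Adj b z → z ∈ B) :
    Even (H.degree b) := by
  have hbw : ¬ H.Adj b w := fun hbw => hw (hbB w hbw)
  rw [← SimpleGraph.card_neighborFinset_eq_degree]
  refine even_card_of_forall_degree_eq_one (F := F) (fun s hs => ?_) fun s hs x hsx => ?_ <;>
    rw [SimpleGraph.mem_neighborFinset] at hs
  · exact h.degree_eq hs.ne' fun hsw => hbw (hsw ▸ hs)
  · rw [SimpleGraph.mem_neighborFinset]
    exact (h.sdiff_adj_of_adj hno one_pos hclique (by omega) hb hw hbw (by omega)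
      (mem_erase.2 ⟨hs.ne', hbB s hs⟩) hsx).1

/-- The augmenting trail is `b p z x s`, where `x` and `p` are the `F`-neighbours of `s` and `z`,
and `z ∈ B` is a neighbour of `x`. It ends in the clique. -/
theorem hasFactor_of_adj_of_adj (h : NearFactor H F 1 b w) (hB : IsNearClique l δ H B)
    (hn : 2 * #B + 6 < Fintype.card V) (hb : b ∈ B) (hw : w ∉ B) (hbw : ¬ H.Adj b w)
    (hcard : #B ≤ H.degree b + 1) (hs : s ∉ B) (hbs : H.Adj b s) (hy : y ∈ B) (hby : H.Adj b y) :
    HasFactor H 1 := by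
  by_contra hno
  have hne : b ≠ w := fun hbw => hw (hbw ▸ hb)
  have hmem {z x} (hbz : H.Adj b z) : F.Adj z x → x ∈ B.erase b :=
    h.mem_erase_of_adj hno one_pos hB.isClique (by omega) hw ((h.sdiff_adj_left_iff hne).2 hbz)
  have hspare {x z} : x ∈ B.erase b → F.Adj x z → (H \ F).Adj b z :=
    h.sdiff_adj_of_adj hno one_pos hB.isClique (by omega) hb hw hbw (by omega)
  obtain ⟨x, hsx⟩ := h.exists_adj one_pos hbs.ne' fun hsw => hbw (hsw ▸ hbs)
  have hx := mem_erase.1 (hmem hbs hsx)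
  have hbx : ¬ H.Adj b x := fun hbx => hs (mem_of_mem_erase (hmem hbx hsx.symm))
  obtain ⟨z, hz, hxz⟩ : ∃ z ∈ B, H.Adj x z := by
    by_contra! hcon
    have hlt : H.degree x < H.degree b := by
      refine card_lt_card (ssubset_iff_of_subset (fun z hz => ?_) |>.2
        ⟨y, by simpa using hby, by simpa using hcon y hy⟩)
      rw [SimpleGraph.mem_neighborFinset] at hz ⊢
      exact hB.adj_of_adj hx.2 (fun hzB => hcon z hzB hz) hz hb
    rw [hB.degree_eq_of_not_adj hb hw hbw hb, hB.degree_eq_of_not_adj hb hw hbw hx.2] at hlt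
    exact hlt.ne rfl
  have hzb : z ≠ b := fun hzb => hbx (hzb ▸ hxz.symm)
  obtain ⟨p, hzp⟩ := h.exists_adj one_pos hzb fun hzw => hw (hzw ▸ hz)
  have hbp := hspare (mem_erase.2 ⟨hzb, hz⟩) hzp
  have hzx : (H \ F).Adj z x := ⟨hxz.symm, fun hzx =>
    hs (eq_of_adj_of_degree_le_one (h.degree_le x) hsx.symm hzx.symm ▸ hz)⟩
  exact hno <| (h.switch_switch hbp hzp.symm hzx hsx.symm).hasFactor_of_isClique one_pos
    hB.isClique (by omega) hs hw

end NearFactor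
end Completion

section Isomorphisms

variable {V V₁ V₂ W₁ W₂ : Type*} {H : SimpleGraph V} {G₁ : SimpleGraph V₁} {G₂ : SimpleGraph V₂}
  {H₁ : SimpleGraph W₁} {H₂ : SimpleGraph W₂} {s : Set V} {m : ℕ}

theorem nonempty_iso_sum (hs : ∀ u ∈ s, ∀ v ∉ s, ¬ H.Adj u v)
    (h₁ : Nonempty (H.induce s ≃g G₁)) (h₂ : Nonempty (H.induce sᶜ ≃g G₂)) :
    Nonempty (H ≃g G₁ ⊕g G₂) := by
  classical
  obtain ⟨f₁⟩ := h₁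
  obtain ⟨f₂⟩ := h₂
  suffices f : H.induce s ⊕g H.induce sᶜ ≃g H from ⟨f.symm.trans (f₁.sumCongr f₂)⟩
  refine ⟨Equiv.Set.sumCompl s, ?_⟩
  rintro (⟨u, hu⟩ | ⟨u, hu⟩) (⟨v, hv⟩ | ⟨v, hv⟩)
  · simp
  · simpa using hs u hu v hv
  · simpa [H.adj_comm] using hs v hv u hu
  · simp

/-- The isomorphism of joins induced by isomorphisms of the two parts, cf.
`SimpleGraph.Iso.sumCongr`. -/
def joinCongr (f₁ : H₁ ≃g G₁) (f₂ : H₂ ≃g G₂) : join H₁ H₂ ≃g join G₁ G₂ where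
  toEquiv := f₁.toEquiv.sumCongr f₂.toEquiv
  map_rel_iff' := by
    rintro (u | u) (v | v)
    · simpa [join] using f₁.map_rel_iff
    · simp [join]
    · simp [join]
    · simpa [join] using f₂.map_rel_iff

theorem nonempty_iso_join (hs : ∀ u ∈ s, ∀ v ∉ s, H.Adj u v)
    (h₁ : Nonempty (H.induce s ≃g G₁)) (h₂ : Nonempty (H.induce sᶜ ≃g G₂)) :
    Nonempty (H ≃g join G₁ G₂) := by
  classical
  obtain ⟨f₁⟩ := h₁
  obtain ⟨f₂⟩ := h₂
  suffices f : join (H.induce s) (H.induce sᶜ) ≃g H from ⟨f.symm.trans (joinCongr f₁ f₂)⟩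
  refine ⟨Equiv.Set.sumCompl s, ?_⟩
  rintro (⟨u, hu⟩ | ⟨u, hu⟩) (⟨v, hv⟩ | ⟨v, hv⟩)
  · simp [join]
  · simpa [join] using hs u hu v hv
  · simpa [join, H.adj_comm] using hs v hv u hu
  · simp [join]

variable [Finite V]

theorem nonempty_iso_completeGraph (hs : H.IsClique s) (hm : s.ncard = m) :
    Nonempty (H.induce s ≃g SimpleGraph.completeGraph (Fin m)) := by
  rw [SimpleGraph.induce_eq_top.2 hs]
  exact ⟨SimpleGraph.Iso.completeGraph (Finite.equivFinOfCardEq hm)⟩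

theorem nonempty_iso_emptyGraph (hs : H.IsIndepSet s) (hm : s.ncard = m) :
    Nonempty (H.induce s ≃g SimpleGraph.emptyGraph (Fin m)) := by
  refine ⟨Finite.equivFinOfCardEq hm, fun {u v} => ?_⟩
  simpa using fun huv => hs u.2 v.2 (H.ne_of_adj huv) huv

end Isomorphisms

section Main

variable {V : Type*} [Fintype V] {G H : SimpleGraph V} {k l δ : ℕ} {B : Finset V} {b : V}

namespace IsNearClique

theorem nonempty_iso_completeGraph_sum (h : IsNearClique l δ H B) (hcard : #B = δ + 1) (hb : b ∈ B)
    (hbB : ∀ z, H.Adj b z → z ∈ B) (hdeg : ∀ b' ∈ B, H.degree b' = δ) :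
    Nonempty (H ≃g SimpleGraph.completeGraph (Fin (Fintype.card V - δ - 1)) ⊕g
      SimpleGraph.completeGraph (Fin (δ + 1))) := by
  have hcross {u z} (hu : u ∈ B) (hz : z ∉ B) : ¬ H.Adj u z := fun huz =>
    hz (hbB z (h.adj_of_adj hu hz huz hb))
  have hnbr {u} (hu : u ∈ B) : H.neighborFinset u = B.erase u := by
    refine eq_of_subset_of_card_le (fun z hz => ?_) ?_
    · rw [SimpleGraph.mem_neighborFinset] at hz
      exact mem_erase.2 ⟨hz.ne', by_contra fun hzB => hcross hu hzB hz⟩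
    · rw [card_erase_of_mem hu, hcard, H.card_neighborFinset_eq_degree, hdeg u hu]
      exact le_rfl
  have hclique : H.IsClique (B : Set V)ᶜᶜ := by
    rw [compl_compl]
    intro u hu v hv huv
    rw [← H.mem_neighborFinset, hnbr hu]
    exact mem_erase.2 ⟨huv.symm, hv⟩
  refine nonempty_iso_sum (s := (B : Set V)ᶜ)
    (fun u hu v hv huv => hcross (by simpa using hv) (by simpa using hu) huv.symm)
    (nonempty_iso_completeGraph h.isClique ?_) (nonempty_iso_completeGraph hclique ?_)
  · rw [← coe_compl, Set.ncard_coe_finset, card_compl]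
    omega
  · rw [compl_compl, Set.ncard_coe_finset, hcard]

theorem nonempty_iso_completeGraph_join (h : IsNearClique l δ H B) (hcard : #B = δ + 1) (hb : b ∈ B)
    (hbB : ∀ z ∈ B, ¬ H.Adj b z) (hdeg : ∀ b' ∈ B, H.degree b' = δ) :
    Nonempty (H ≃g join (SimpleGraph.completeGraph (Fin δ))
      (SimpleGraph.completeGraph (Fin (Fintype.card V - 2 * δ - 1)) ⊕g
        SimpleGraph.emptyGraph (Fin (δ + 1)))) := by
  have hS {z} (hbz : H.Adj b z) : z ∉ B := fun hz => hbB z hz hbz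
  have hnbr {u z} (hu : u ∈ B) : H.Adj u z ↔ H.Adj b z := by
    have hsub : H.neighborFinset b ⊆ H.neighborFinset u := fun z hz => by
      rw [SimpleGraph.mem_neighborFinset] at hz ⊢
      exact h.adj_of_adj hb (hS hz) hz hu
    have heq := eq_of_subset_of_card_le hsub (by simp [hdeg u hu, hdeg b hb])
    rw [← H.mem_neighborFinset, ← heq, H.mem_neighborFinset]
  have hcardS : (H.neighborSet b).ncard = δ := by
    rw [← H.coe_neighborFinset, Set.ncard_coe_finset, H.card_neighborFinset_eq_degree, hdeg b hb]
  have hsub : H.neighborSet b ⊆ (B : Set V)ᶜ := fun z hz => by simpa using hS hz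
  refine nonempty_iso_join (s := H.neighborSet b) (fun _ hu v hv => ?_)
    (nonempty_iso_completeGraph (h.isClique.subset hsub) hcardS) <|
    nonempty_iso_sum (s := Subtype.val ⁻¹' (B : Set V)ᶜ) (fun u _ v hv huv => ?_)
      (nonempty_iso_completeGraph (fun _ hu _ hv huv => ?_) ?_)
      (nonempty_iso_emptyGraph (fun u hu v _ _ huv => ?_) ?_)
  · by_cases hvB : v ∈ B
    · exact ((hnbr hvB).2 hu).symm
    · exact h.isClique (hsub hu) (by simpa using hvB) fun huv => hv (huv ▸ hu)
  · exact u.2 ((hnbr (by simpa using hv)).1 huv.symm)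
  · exact h.isClique hu hv (Subtype.coe_ne_coe.2 huv)
  · have hdiff := Set.ncard_sdiff_add_ncard_of_subset hsub
    rw [← coe_compl, Set.ncard_coe_finset, card_compl, hcard, hcardS] at hdiff
    rw [← Set.ncard_image_of_injective _ Subtype.val_injective, Subtype.image_preimage_val,
      Set.inter_comm, ← Set.sdiff_eq, ← coe_compl]
    omega
  · exact v.2 ((hnbr (by simpa using hu)).1 huv)
  · rw [← Set.preimage_compl, compl_compl, Set.ncard_preimage_of_injective_subset_range
      Subtype.val_injective, Set.ncard_coe_finset, hcard]
    simpa [Set.subset_def] using hbB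

theorem hasFactor_one_or_nonempty_iso (h : IsNearClique (Fintype.card V - 1) δ H B)
    (hn : 6 * δ + 10 ≤ Fintype.card V) (heven : Even (Fintype.card V)) :
    HasFactor H 1 ∨
      (Even δ ∧ Nonempty (H ≃g SimpleGraph.completeGraph (Fin (Fintype.card V - δ - 1)) ⊕g
        SimpleGraph.completeGraph (Fin (δ + 1)))) ∨
      Nonempty (H ≃g join (SimpleGraph.completeGraph (Fin δ))
        (SimpleGraph.completeGraph (Fin (Fintype.card V - 2 * δ - 1)) ⊕g
          SimpleGraph.emptyGraph (Fin (δ + 1)))) := by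
  refine or_iff_not_imp_left.2 fun hno => ?_
  obtain ⟨b, hb, w, hw, hbw, F, hF⟩ := (h.hasFactor_or_exists_nearFactor (k := 1) (by omega)
    (by omega) (by simpa using heven) (by omega)).resolve_left hno
  have hcard : #B = δ + 1 := by
    have := h.card_eq_of_not_adj hb hw hbw
    omega
  have hdeg (b') (hb' : b' ∈ B) : H.degree b' = δ := h.degree_eq_of_not_adj hb hw hbw hb'
  by_cases hbB : ∀ z, H.Adj b z → z ∈ B
  · have heven := hF.even_degree hno h.isClique (by omega) hb hw (by rw [hcard, hdeg b hb]) hbB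
    rw [hdeg b hb] at heven
    exact Or.inl ⟨heven, h.nonempty_iso_completeGraph_sum hcard hb hbB hdeg⟩
  · push Not at hbB
    obtain ⟨s, hbs, hs⟩ := hbB
    refine Or.inr (h.nonempty_iso_completeGraph_join hcard hb (fun y hy hby => hno ?_) hdeg)
    exact hF.hasFactor_of_adj_of_adj h (by omega) hb hw hbw (by rw [hcard, hdeg b hb]) hs hbs hy hby

theorem hasFactor_of_two_le (h : IsNearClique (Fintype.card V + 2 * k - 4) δ H B) (hk : 2 ≤ k)
    (hδ : 2 * k - 2 ≤ δ) (hn : 6 * δ + 4 * k - 3 ≤ Fintype.card V)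
    (heven : Even (Fintype.card V * k)) : HasFactor H k := by
  obtain hH | ⟨b, hb, w, hw, hbw, F, hF⟩ := h.hasFactor_or_exists_nearFactor (by omega) (by omega)
    heven (by omega)
  · exact hH
  have hcard := h.card_eq_of_not_adj hb hw hbw
  have hdeg := h.degree_eq_of_not_adj hb hw hbw hb
  exact hF.hasFactor_of_two_le hk h (by omega) hb hw hbw (by omega) (by omega)

end IsNearClique

theorem exists_isNearClique_closure (hδ : ∀ v, δ ≤ G.degree v) (hδl : 2 * δ + 2 ≤ l)
    (hl : l ≤ 2 * Fintype.card V)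
    (hdeg : ∀ B : Finset V, Fintype.card V + δ < l + #B → 2 * #B + l ≤ 2 * Fintype.card V →
      ∃ v ∈ B, #B + l < (closure l G).degree v + Fintype.card V) :
    ∃ B, IsNearClique l δ (closure l G) B :=
  (closure_spec l G).isDegreeSumClosed.exists_isNearClique
    (fun v => (hδ v).trans (SimpleGraph.degree_le_of_le (closure_spec l G).le)) hδl hl hdeg

end Main

end FactorSpectral

theorem corollary1p8 {V : Type*} [Fintype V] [DecidableEq V] (G : SimpleGraph V)
    [DecidableRel G.Adj] (n δ : ℕ) (hn : Fintype.card V = n) (hδ : δ ≤ G.minDegree) :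
    (Even n → 1 ≤ δ → (δ : ℝ) ≤ (n : ℝ) / 2 - 1 → 6 * δ + 10 ≤ n →
      ((δ : ℝ) - 1) / 2 + √((n : ℝ) ^ 2 - (3 * (δ : ℝ) + 5) * (n : ℝ)
          + (13 * (δ : ℝ) ^ 2 + 23 * (δ : ℝ) + 41) / 4) < FactorSpectral.spectralRadius G →
      FactorSpectral.HasFactor G 1 ∨
      (Even δ ∧ Nonempty (FactorSpectral.closure (n - 1) G ≃g
        (SimpleGraph.completeGraph (Fin (n - δ - 1)) ⊕g
          SimpleGraph.completeGraph (Fin (δ + 1))))) ∨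
      Nonempty (FactorSpectral.closure (n - 1) G ≃g
        FactorSpectral.join (SimpleGraph.completeGraph (Fin δ))
          (SimpleGraph.completeGraph (Fin (n - 2 * δ - 1)) ⊕g
            SimpleGraph.emptyGraph (Fin (δ + 1))))) ∧
    (∀ k : ℕ, 2 ≤ k → Even (n * k) →
      2 * (k : ℤ) - 2 ≤ (δ : ℤ) → (δ : ℤ) ≤ ⌊((n : ℝ) + 2 * (k : ℝ) - 5) / 2⌋ →
      6 * (δ : ℤ) + 4 * (k : ℤ) - 3 ≤ (n : ℤ) →
      ((δ : ℝ) - 1) / 2 + √((n : ℝ) ^ 2 - (3 * (δ : ℝ) - 4 * (k : ℝ) + 11) * (n : ℝ)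
          + (13 * (δ : ℝ) ^ 2 - (32 * (k : ℝ) - 94) * (δ : ℝ) + 16 * (k : ℝ) ^ 2
            - 104 * (k : ℝ) + 161) / 4) < FactorSpectral.spectralRadius G →
      FactorSpectral.HasFactor G k) := by
  classical
  subst hn
  have hδG (v) : δ ≤ G.degree v := hδ.trans (G.minDegree_le_degree v)
  refine ⟨fun heven _ _ hn hρ => ?_, fun k hk heven hkδ _ hn hρ => ?_⟩
  · have hcl := FactorSpectral.closure_spec (Fintype.card V - 1) G
    obtain ⟨B, hB⟩ := FactorSpectral.exists_isNearClique_closure (l := Fintype.card V - 1)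
      (fun v => by convert hδG v) (by omega) (by omega) fun B hδB hB => by
        convert FactorSpectral.exists_lt_degree_of_matching_bound hcl.le hn hρ (by omega) hB
    exact (hB.hasFactor_one_or_nonempty_iso hn heven).imp_left (.of_reflTransGen (by omega) hcl.1)
  · have hcl := FactorSpectral.closure_spec (Fintype.card V + 2 * k - 4) G
    obtain ⟨B, hB⟩ := FactorSpectral.exists_isNearClique_closure (l := Fintype.card V + 2 * k - 4)
      (fun v => by convert hδG v) (by omega) (by omega) fun B hδB hB => by
        convert FactorSpectral.exists_lt_degree_of_factor_bound hcl.le hk (by omega) (by omega) hρ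
          (by omega) hB
    exact .of_reflTransGen (by omega) hcl.1 (hB.hasFactor_of_two_le hk (by omega) (by omega) heven)
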